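/- Formulas are built from propositional letters, $\bot$ and $\top$ with the binary connectives $\wedge,\vee,\cdot,\rightarrow,\leftarrow$. Formula structures are built from formulas with two binary operations $\odot$ and $\barwedge$ (there is no empty structure). A sequent is an expression $\Gamma\Rightarrow A$ with $\Gamma$ a formula structure and $A$ a formula; $\Gamma[\Delta]$ denotes a structure with a distinguished occurrence of the substructure $\Delta$. The sequent calculus $\mathsf{L^m_{RBL}}$ has the axioms $A\Rightarrow A$, $A\Rightarrow\top$ and $\bot\Rightarrow A$ (for formulas $A$), the logical rules $$\frac{\Delta\Rightarrow A\quad \Gamma[B]\Rightarrow C}{\Gamma[\Delta\odot(A\rightarrow B)]\Rightarrow C}\qquad \frac{A\odot\Gamma\Rightarrow B}{\Gamma\Rightarrow A\rightarrow B}\qquad \frac{\Gamma[A]\Rightarrow C\quad \Delta\Rightarrow B}{\Gamma[(A\leftarrow B)\odot\Delta]\Rightarrow C}\qquad \frac{\Gamma\odot B\Rightarrow A}{\Gamma\Rightarrow A\leftarrow B}$$ $$\frac{\Gamma[A\odot B]\Rightarrow C}{\Gamma[A\cdot B]\Rightarrow C}\qquad \frac{\Gamma\Rightarrow A\quad \Delta\Rightarrow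 B}{\Gamma\odot\Delta\Rightarrow A\cdot B}\qquad \frac{\Gamma[A\barwedge B]\Rightarrow C}{\Gamma[A\wedge B]\Rightarrow C}\qquad \frac{\Gamma\Rightarrow A\quad \Gamma\Rightarrow B}{\Gamma\Rightarrow A\wedge B}$$ $$\frac{\Gamma[A]\Rightarrow C\quad \Gamma[B]\Rightarrow C}{\Gamma[A\vee B]\Rightarrow C}\qquad \frac{\Gamma\Rightarrow A_i}{\Gamma\Rightarrow A_1\vee A_2}\ (i=1,2),$$ the structural rules $$\frac{\Gamma[\Delta\barwedge\Delta]\Rightarrow A}{\Gamma[\Delta]\Rightarrow A}\qquad \frac{\Gamma[(\Lambda\odot\Delta)\odot\Delta]\Rightarrow A}{\Gamma[\Lambda\odot\Delta]\Rightarrow A}\qquad \frac{\Gamma[\Delta\barwedge\Lambda]\Rightarrow A}{\Gamma[\Lambda\barwedge\Delta]\Rightarrow A}$$ $$\frac{\Gamma[\Delta]\Rightarrow A}{\Gamma[\Delta'*\Delta]\Rightarrow A}\qquad \frac{\Gamma[\Delta]\Rightarrow A}{\Gamma[\Delta*\Delta']\Rightarrow A}\quad (*\in\{\barwedge,\odot\})$$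 $$\frac{\Gamma[(\Delta_1\barwedge\Delta_2)\barwedge\Delta_3]\Rightarrow A}{\Gamma[\Delta_1\barwedge(\Delta_2\barwedge\Delta_3)]\Rightarrow A}\qquad \frac{\Gamma[\Delta_1\barwedge(\Delta_2\barwedge\Delta_3)]\Rightarrow A}{\Gamma[(\Delta_1\barwedge\Delta_2)\barwedge\Delta_3]\Rightarrow A},$$ and the rule $$(\mathrm{Mix})\quad \frac{\Delta\Rightarrow A\qquad \Gamma[A]\ldots[A]\Rightarrow B}{\Gamma[\Delta]\ldots[\Delta]\Rightarrow B},$$ where $A$ is a formula, called the mix formula, and the conclusion results from the second premise by replacing one or more occurrences of $A$ as a substructure of its antecedent (not necessarily all of them) by the structure $\Delta$. **Theorem.** Every sequent $\Gamma\Rightarrow A$ that is derivable in $\mathsf{L^m_{RBL}}$ has a derivation in $\mathsf{L^m_{RBL}}$ in which every application of $(\mathrm{Mix})$ has mix formula $\bot$ or $\top$. -/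

import Mathlib

namespace RBL

universe u

/-- Formulas of residuated basic logic over a set `α` of propositional letters:
`p | ⊥ | ⊤ | A ∧ B | A ∨ B | A · B | A → B | A ← B`. -/
inductive Form (α : Type u) : Type u
  | var (p : α) : Form α
  | bot : Form α
  | top : Form α
  | and (A B : Form α) : Form α
  | or (A B : Form α) : Form α
  | prod (A B : Form α) : Form α
  /-- `imp A B` is `A → B`. -/
  | imp (A B : Form α) : Form α
  /-- `limp A B` is `A ← B`. -/
  | limp (A B : Form α) : Form α

/-- Formula structures, built from formulas with `⊙` (`odot`) and `⩓` (`owedge`).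
There is no empty structure. -/
inductive Str (α : Type u) : Type u
  | form (A : Form α) : Str α
  | odot (Γ Δ : Str α) : Str α
  | owedge (Γ Δ : Str α) : Str α

/-- One-hole contexts `Γ[ ]`. -/
inductive Ctx (α : Type u) : Type u
  | hole : Ctx α
  | odotL (Γ : Ctx α) (Δ : Str α) : Ctx α
  | odotR (Δ : Str α) (Γ : Ctx α) : Ctx α
  | owedgeL (Γ : Ctx α) (Δ : Str α) : Ctx α
  | owedgeR (Δ : Str α) (Γ : Ctx α) : Ctx α

/-- `Γ.fill Δ` is the structure `Γ[Δ]`. -/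
def Ctx.fill {α : Type u} : Ctx α → Str α → Str α
  | .hole, Θ => Θ
  | .odotL Γ Δ, Θ => .odot (Γ.fill Θ) Δ
  | .odotR Δ Γ, Θ => .odot Δ (Γ.fill Θ)
  | .owedgeL Γ Δ, Θ => .owedge (Γ.fill Θ) Δ
  | .owedgeR Δ Γ, Θ => .owedge Δ (Γ.fill Θ)

/-- Contexts `Γ[ ]…[ ]` with any number of holes. -/
inductive MCtx (α : Type u) : Type u
  | hole : MCtx α
  | form (A : Form α) : MCtx α
  | odot (Γ Δ : MCtx α) : MCtx α
  | owedge (Γ Δ : MCtx α) : MCtx α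

/-- `Γ.fill Δ` is `Γ[Δ]…[Δ]`: every hole of `Γ` is filled with the same structure `Δ`. -/
def MCtx.fill {α : Type u} : MCtx α → Str α → Str α
  | .hole, Θ => Θ
  | .form A, _ => .form A
  | .odot Γ Δ, Θ => .odot (Γ.fill Θ) (Δ.fill Θ)
  | .owedge Γ Δ, Θ => .owedge (Γ.fill Θ) (Δ.fill Θ)

/-- The number of holes. -/
def MCtx.numHoles {α : Type u} : MCtx α → ℕ
  | .hole => 1
  | .form _ => 0
  | .odot Γ Δ => Γ.numHoles + Δ.numHoles
  | .owedge Γ Δ => Γ.numHoles + Δ.numHoles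

/-- `Deriv Γ A` is the type of derivations (proof trees) of the sequent `Γ ⇒ A` in the
sequent calculus with the rule Mix. -/
inductive Deriv {α : Type u} : Str α → Form α → Type u
  | id (A : Form α) : Deriv (.form A) A
  | topAx (A : Form α) : Deriv (.form A) .top
  | botAx (A : Form α) : Deriv (.form .bot) A
  | impL (Γ : Ctx α) (Δ : Str α) (A B C : Form α) :
      Deriv Δ A → Deriv (Γ.fill (.form B)) C →
      Deriv (Γ.fill (.odot Δ (.form (.imp A B)))) C
  | impR (Γ : Str α) (A B : Form α) :
      Deriv (.odot (.form A) Γ) B → Deriv Γ (.imp A B)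
  | limpL (Γ : Ctx α) (Δ : Str α) (A B C : Form α) :
      Deriv (Γ.fill (.form A)) C → Deriv Δ B →
      Deriv (Γ.fill (.odot (.form (.limp A B)) Δ)) C
  | limpR (Γ : Str α) (A B : Form α) :
      Deriv (.odot Γ (.form B)) A → Deriv Γ (.limp A B)
  | prodL (Γ : Ctx α) (A B C : Form α) :
      Deriv (Γ.fill (.odot (.form A) (.form B))) C → Deriv (Γ.fill (.form (.prod A B))) C
  | prodR (Γ Δ : Str α) (A B : Form α) :
      Deriv Γ A → Deriv Δ B → Deriv (.odot Γ Δ) (.prod A B)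
  | andL (Γ : Ctx α) (A B C : Form α) :
      Deriv (Γ.fill (.owedge (.form A) (.form B))) C → Deriv (Γ.fill (.form (.and A B))) C
  | andR (Γ : Str α) (A B : Form α) :
      Deriv Γ A → Deriv Γ B → Deriv Γ (.and A B)
  | orL (Γ : Ctx α) (A B C : Form α) :
      Deriv (Γ.fill (.form A)) C → Deriv (Γ.fill (.form B)) C →
      Deriv (Γ.fill (.form (.or A B))) C
  | orR₁ (Γ : Str α) (A B : Form α) : Deriv Γ A → Deriv Γ (.or A B)
  | orR₂ (Γ : Str α) (A B : Form α) : Deriv Γ B → Deriv Γ (.or A B)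
  /-- contraction for `⩓` -/
  | owedgeC (Γ : Ctx α) (Δ : Str α) (A : Form α) :
      Deriv (Γ.fill (.owedge Δ Δ)) A → Deriv (Γ.fill Δ) A
  /-- restricted contraction for `⊙` -/
  | odotC (Γ : Ctx α) (Λ Δ : Str α) (A : Form α) :
      Deriv (Γ.fill (.odot (.odot Λ Δ) Δ)) A → Deriv (Γ.fill (.odot Λ Δ)) A
  /-- exchange for `⩓` -/
  | owedgeE (Γ : Ctx α) (Δ Λ : Str α) (A : Form α) :
      Deriv (Γ.fill (.owedge Δ Λ)) A → Deriv (Γ.fill (.owedge Λ Δ)) A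
  /-- weakening on the left and on the right, for `⩓` and for `⊙` -/
  | owedgeW₁ (Γ : Ctx α) (Δ Δ' : Str α) (A : Form α) :
      Deriv (Γ.fill Δ) A → Deriv (Γ.fill (.owedge Δ' Δ)) A
  | odotW₁ (Γ : Ctx α) (Δ Δ' : Str α) (A : Form α) :
      Deriv (Γ.fill Δ) A → Deriv (Γ.fill (.odot Δ' Δ)) A
  | owedgeW₂ (Γ : Ctx α) (Δ Δ' : Str α) (A : Form α) :
      Deriv (Γ.fill Δ) A → Deriv (Γ.fill (.owedge Δ Δ')) A
  | odotW₂ (Γ : Ctx α) (Δ Δ' : Str α) (A : Form α) :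
      Deriv (Γ.fill Δ) A → Deriv (Γ.fill (.odot Δ Δ')) A
  /-- associativity for `⩓` -/
  | owedgeA₁ (Γ : Ctx α) (Δ₁ Δ₂ Δ₃ : Str α) (A : Form α) :
      Deriv (Γ.fill (.owedge (.owedge Δ₁ Δ₂) Δ₃)) A →
      Deriv (Γ.fill (.owedge Δ₁ (.owedge Δ₂ Δ₃))) A
  | owedgeA₂ (Γ : Ctx α) (Δ₁ Δ₂ Δ₃ : Str α) (A : Form α) :
      Deriv (Γ.fill (.owedge Δ₁ (.owedge Δ₂ Δ₃))) A →
      Deriv (Γ.fill (.owedge (.owedge Δ₁ Δ₂) Δ₃)) A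
  /-- Mix with mix formula `A`: at least one chosen occurrence of `A` is replaced by `Δ`.
  Unchosen occurrences of `A` may remain in the context `Γ`. -/
  | mix (Γ : MCtx α) (Δ : Str α) (A B : Form α) (h : 1 ≤ Γ.numHoles) :
      Deriv Δ A → Deriv (Γ.fill (.form A)) B → Deriv (Γ.fill Δ) B

/-- The set of mix formulas of all applications of Mix in a derivation. -/
def Deriv.mixFormulas {α : Type u} {Γ : Str α} {A : Form α} : Deriv Γ A → Set (Form α)
  | .id _ => ∅
  | .topAx _ => ∅
  | .botAx _ => ∅
  | .impL _ _ _ _ _ d e => d.mixFormulas ∪ e.mixFormulas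
  | .impR _ _ _ d => d.mixFormulas
  | .limpL _ _ _ _ _ d e => d.mixFormulas ∪ e.mixFormulas
  | .limpR _ _ _ d => d.mixFormulas
  | .prodL _ _ _ _ d => d.mixFormulas
  | .prodR _ _ _ _ d e => d.mixFormulas ∪ e.mixFormulas
  | .andL _ _ _ _ d => d.mixFormulas
  | .andR _ _ _ d e => d.mixFormulas ∪ e.mixFormulas
  | .orL _ _ _ _ d e => d.mixFormulas ∪ e.mixFormulas
  | .orR₁ _ _ _ d => d.mixFormulas
  | .orR₂ _ _ _ d => d.mixFormulas
  | .owedgeC _ _ _ d => d.mixFormulas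
  | .odotC _ _ _ _ d => d.mixFormulas
  | .owedgeE _ _ _ _ d => d.mixFormulas
  | .owedgeW₁ _ _ _ _ d => d.mixFormulas
  | .odotW₁ _ _ _ _ d => d.mixFormulas
  | .owedgeW₂ _ _ _ _ d => d.mixFormulas
  | .odotW₂ _ _ _ _ d => d.mixFormulas
  | .owedgeA₁ _ _ _ _ _ d => d.mixFormulas
  | .owedgeA₂ _ _ _ _ _ d => d.mixFormulas
  | .mix _ _ A _ _ d e => insert A (d.mixFormulas ∪ e.mixFormulas)

/-- Derivability of the sequent `Γ ⇒ A` in the calculus with Mix. -/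
def Derivable {α : Type u} (Γ : Str α) (A : Form α) : Prop := Nonempty (Deriv Γ A)

end RBL

namespace RBL

universe u

variable {α : Type u}

/-! Mix elimination by a semantic argument: formulas are interpreted by sets of structures closed
under the Galois connection given by Mix-free provability, every derivation (Mix included) is sound
for the interpretation, and validity implies Mix-free provability. -/

/-! The key fact is that each formula `A` satisfies `A ∈ A.sem` and `A.sem ⊆ {Γ | MixFree Γ A}`
(`Form.mem_sem_and_mixFree`). Validity, applied to the antecedent as an instance of itself,
therefore yields a Mix-free derivation. Soundness (`Deriv.valid`) costs nothing for Mix, which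
becomes composition of inclusions; closedness of `A.sem` handles the rules acting inside a context.
Mix on `⊥` and `⊤` disappears too, because weakening is available everywhere. -/

/-- Composition of one-hole contexts. -/
def Ctx.comp : Ctx α → Ctx α → Ctx α
  | .hole, H => H
  | .odotL Γ Δ, H => .odotL (Γ.comp H) Δ
  | .odotR Δ Γ, H => .odotR Δ (Γ.comp H)
  | .owedgeL Γ Δ, H => .owedgeL (Γ.comp H) Δ
  | .owedgeR Δ Γ, H => .owedgeR Δ (Γ.comp H)

theorem Ctx.fill_comp (G H : Ctx α) (x : Str α) : (G.comp H).fill x = G.fill (H.fill x) := by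
  induction G <;> simp_all [Ctx.comp, Ctx.fill]

/-- Provability without Mix. -/
def MixFree (Γ : Str α) (A : Form α) : Prop := ∃ d : Deriv Γ A, d.mixFormulas = ∅

theorem MixFree.lift {Γ Δ : Str α} {A B : Form α} (f : Deriv Γ A → Deriv Δ B)
    (hf : ∀ d, (f d).mixFormulas = d.mixFormulas) (h : MixFree Γ A) : MixFree Δ B := by
  obtain ⟨d, hd⟩ := h
  exact ⟨f d, (hf d).trans hd⟩

theorem MixFree.lift₂ {Γ Γ' Δ : Str α} {A A' B : Form α}
    (f : Deriv Γ A → Deriv Γ' A' → Deriv Δ B)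
    (hf : ∀ d e, (f d e).mixFormulas = d.mixFormulas ∪ e.mixFormulas)
    (h : MixFree Γ A) (h' : MixFree Γ' A') : MixFree Δ B := by
  obtain ⟨d, hd⟩ := h
  obtain ⟨e, he⟩ := h'
  exact ⟨f d e, by rw [hf, hd, he, Set.union_empty]⟩

/-- `x` may replace `y` in the antecedent of every Mix-free provable sequent. -/
def Replaces (x y : Str α) : Prop :=
  ∀ (G : Ctx α) (C : Form α), MixFree (G.fill y) C → MixFree (G.fill x) C

/-- Weakening builds the context around the axiom `⊥ ⇒ C`, layer by layer. -/
theorem MixFree.botL (G : Ctx α) (C : Form α) : MixFree (G.fill (.form .bot)) C := by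
  induction G with
  | hole => exact ⟨.botAx C, rfl⟩
  | odotL Γ Δ ih => exact ih.lift (.odotW₂ .hole _ Δ C) fun _ => rfl
  | odotR Δ Γ ih => exact ih.lift (.odotW₁ .hole _ Δ C) fun _ => rfl
  | owedgeL Γ Δ ih => exact ih.lift (.owedgeW₂ .hole _ Δ C) fun _ => rfl
  | owedgeR Δ Γ ih => exact ih.lift (.owedgeW₁ .hole _ Δ C) fun _ => rfl

theorem MixFree.topR (Γ : Str α) : MixFree Γ .top := by
  induction Γ with
  | form A => exact ⟨.topAx A, rfl⟩
  | odot Γ Δ ih _ => exact ih.lift (.odotW₂ .hole _ Δ _) fun _ => rfl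
  | owedge Γ Δ ih _ => exact ih.lift (.owedgeW₂ .hole _ Δ _) fun _ => rfl

/-- The closure of a set of structures with respect to Mix-free provability in context. -/
def clo (S : Set (Str α)) : Set (Str α) :=
  {x | ∀ (G : Ctx α) (C : Form α), (∀ y ∈ S, MixFree (G.fill y) C) → MixFree (G.fill x) C}

/-- Closed sets of structures. -/
def Closed (S : Set (Str α)) : Prop := clo S ⊆ S

theorem subset_clo (S : Set (Str α)) : S ⊆ clo S := fun x hx _ _ h => h x hx

theorem closed_clo (S : Set (Str α)) : Closed (clo S) :=
  fun _ hx G C h => hx G C fun _ hy => hy G C h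

theorem Closed.clo_subset {S X : Set (Str α)} (hX : Closed X) (h : S ⊆ X) : clo S ⊆ X :=
  fun _ hx => hX fun G C hy => hx G C fun y hys => hy y (h hys)

theorem Closed.mem_of_replaces {X : Set (Str α)} (hX : Closed X) {x y : Str α}
    (hxy : Replaces x y) (hy : y ∈ X) : x ∈ X :=
  hX fun G C h => hxy G C (h y hy)

theorem Closed.inter {X Y : Set (Str α)} (hX : Closed X) (hY : Closed Y) : Closed (X ∩ Y) :=
  fun _ hx => ⟨hX fun G C h => hx G C fun y hy => h y hy.1,
    hY fun G C h => hx G C fun y hy => h y hy.2⟩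

/-- A test context around `H` composes with `H` to a test context for the hole. This makes residuals
of closed sets closed and lets rules act deep inside a structure. -/
theorem Closed.preimage_fill {X : Set (Str α)} (hX : Closed X) (H : Ctx α) :
    Closed (H.fill ⁻¹' X) := by
  intro x hx
  refine hX fun G C h => ?_
  rw [← Ctx.fill_comp]
  refine hx _ C fun y hy => ?_
  rw [Ctx.fill_comp]
  exact h _ hy

theorem closed_mixFree (A : Form α) : Closed {Γ : Str α | MixFree Γ A} :=
  fun _ hx => hx .hole A fun _ hy => hy

/-- Interpretation of formulas as sets of structures. -/
def Form.sem : Form α → Set (Str α)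
  | .var p => {Γ | MixFree Γ (.var p)}
  | .bot => clo ∅
  | .top => Set.univ
  | .and A B => A.sem ∩ B.sem
  | .or A B => clo (A.sem ∪ B.sem)
  | .prod A B => clo (Set.image2 Str.odot A.sem B.sem)
  | .imp A B => {Γ | ∀ a ∈ A.sem, Str.odot a Γ ∈ B.sem}
  | .limp A B => {Γ | ∀ b ∈ B.sem, Str.odot Γ b ∈ A.sem}

theorem Form.closed_sem (A : Form α) : Closed A.sem := by
  induction A with
  | var p => exact closed_mixFree _
  | bot => exact closed_clo _
  | top => exact fun _ _ => trivial
  | and A B hA hB => exact hA.inter hB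
  | or A B _ _ => exact closed_clo _
  | prod A B _ _ => exact closed_clo _
  | imp A B _ hB =>
    exact fun x hx a ha => hB.preimage_fill (.odotR a .hole)
      fun G C h => hx G C fun y hy => h y (hy a ha)
  | limp A B hA _ =>
    exact fun x hx b hb => hA.preimage_fill (.odotL .hole b)
      fun G C h => hx G C fun y hy => h y (hy b hb)

/-- The two halves need a joint induction: for an implication, each half uses the opposite half for
the antecedent. Left rules give membership, right rules give provability. -/
theorem Form.mem_sem_and_mixFree (A : Form α) :
    Str.form A ∈ A.sem ∧ ∀ Γ ∈ A.sem, MixFree Γ A := by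
  induction A with
  | var p => exact ⟨⟨.id _, rfl⟩, fun _ h => h⟩
  | bot => exact ⟨fun G C _ => .botL G C, fun Γ h => h .hole _ (by simp)⟩
  | top => exact ⟨trivial, fun Γ _ => .topR Γ⟩
  | and A B hA hB =>
    refine ⟨⟨?_, ?_⟩, fun Γ h => (hA.2 Γ h.1).lift₂ (.andR Γ A B) (fun _ _ => rfl) (hB.2 Γ h.2)⟩
    · refine A.closed_sem.mem_of_replaces (fun G C h => ?_) hA.1
      exact (h.lift (.owedgeW₂ G _ (.form B) C) fun _ => rfl).lift (.andL G A B C) fun _ => rfl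
    · refine B.closed_sem.mem_of_replaces (fun G C h => ?_) hB.1
      exact (h.lift (.owedgeW₁ G _ (.form A) C) fun _ => rfl).lift (.andL G A B C) fun _ => rfl
  | or A B hA hB =>
    refine ⟨fun G C h => ?_, fun Γ hΓ => (closed_mixFree (A.or B)).clo_subset ?_ hΓ⟩
    · exact (h _ (.inl hA.1)).lift₂ (.orL G A B C) (fun _ _ => rfl) (h _ (.inr hB.1))
    · rintro Δ (h | h)
      · exact (hA.2 Δ h).lift (.orR₁ Δ A B) fun _ => rfl
      · exact (hB.2 Δ h).lift (.orR₂ Δ A B) fun _ => rfl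
  | prod A B hA hB =>
    refine ⟨fun G C h => ?_, fun Γ hΓ => (closed_mixFree (A.prod B)).clo_subset ?_ hΓ⟩
    · exact (h _ (Set.mem_image2_of_mem hA.1 hB.1)).lift (.prodL G A B C) fun _ => rfl
    · rintro _ ⟨x, hx, y, hy, rfl⟩
      exact (hA.2 x hx).lift₂ (.prodR x y A B) (fun _ _ => rfl) (hB.2 y hy)
  | imp A B hA hB =>
    refine ⟨fun a ha => B.closed_sem.mem_of_replaces (fun G C h => ?_) hB.1, fun Γ hΓ => ?_⟩
    · exact (hA.2 a ha).lift₂ (.impL G a A B C) (fun _ _ => rfl) h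
    · exact (hB.2 _ (hΓ _ hA.1)).lift (.impR Γ A B) fun _ => rfl
  | limp A B hA hB =>
    refine ⟨fun b hb => A.closed_sem.mem_of_replaces (fun G C h => ?_) hA.1, fun Γ hΓ => ?_⟩
    · exact h.lift₂ (.limpL G b A B C) (fun _ _ => rfl) (hB.2 b hb)
    · exact (hA.2 _ (hΓ _ hB.1)).lift (.limpR Γ A B) fun _ => rfl

/-- The instances of a structure: every formula is replaced by a member of its interpretation. -/
def Str.inst : Str α → Set (Str α)
  | .form A => A.sem
  | .odot Γ Δ => Set.image2 Str.odot Γ.inst Δ.inst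
  | .owedge Γ Δ => Set.image2 Str.owedge Γ.inst Δ.inst

theorem Str.mem_inst_self (Γ : Str α) : Γ ∈ Γ.inst := by
  induction Γ with
  | form A => exact A.mem_sem_and_mixFree.1
  | odot Γ Δ h h' => exact Set.mem_image2_of_mem h h'
  | owedge Γ Δ h h' => exact Set.mem_image2_of_mem h h'

/-- `H` is `G` with its side structures frozen at the instances chosen in `x`, so only the hole
still varies. -/
theorem Ctx.exists_of_mem_inst_fill (G : Ctx α) {Δ x : Str α} (hx : x ∈ (G.fill Δ).inst) :
    ∃ (H : Ctx α), ∃ y ∈ Δ.inst, x = H.fill y ∧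
      ∀ (Λ : Str α), ∀ z ∈ Λ.inst, H.fill z ∈ (G.fill Λ).inst := by
  induction G generalizing x with
  | hole => exact ⟨.hole, x, hx, rfl, fun _ _ h => h⟩
  | odotL Γ Θ ih =>
    obtain ⟨a, ha, b, hb, rfl⟩ := hx
    obtain ⟨H, y, hy, rfl, h⟩ := ih ha
    exact ⟨.odotL H b, y, hy, rfl, fun Λ z hz => Set.mem_image2_of_mem (h Λ z hz) hb⟩
  | odotR Θ Γ ih =>
    obtain ⟨a, ha, b, hb, rfl⟩ := hx
    obtain ⟨H, y, hy, rfl, h⟩ := ih hb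
    exact ⟨.odotR a H, y, hy, rfl, fun Λ z hz => Set.mem_image2_of_mem ha (h Λ z hz)⟩
  | owedgeL Γ Θ ih =>
    obtain ⟨a, ha, b, hb, rfl⟩ := hx
    obtain ⟨H, y, hy, rfl, h⟩ := ih ha
    exact ⟨.owedgeL H b, y, hy, rfl, fun Λ z hz => Set.mem_image2_of_mem (h Λ z hz) hb⟩
  | owedgeR Θ Γ ih =>
    obtain ⟨a, ha, b, hb, rfl⟩ := hx
    obtain ⟨H, y, hy, rfl, h⟩ := ih hb
    exact ⟨.owedgeR a H, y, hy, rfl, fun Λ z hz => Set.mem_image2_of_mem ha (h Λ z hz)⟩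

/-- Validity of a sequent under the interpretation. -/
def Valid (Γ : Str α) (A : Form α) : Prop := Γ.inst ⊆ A.sem

theorem Valid.fill {G : Ctx α} {Δ Λ : Str α} {C : Form α} (h : Valid (G.fill Δ) C)
    (hΔ : Λ.inst ⊆ clo Δ.inst) : Valid (G.fill Λ) C := by
  intro x hx
  obtain ⟨H, y, hy, rfl, hH⟩ := G.exists_of_mem_inst_fill hx
  exact (C.closed_sem.preimage_fill H).clo_subset (fun z hz => h (hH Δ z hz)) (hΔ hy)

/-- Not a case of `Valid.fill`: the union of two interpretations comes from two premises, which must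
share the same frozen context. -/
theorem Valid.fill_or {G : Ctx α} {A B C : Form α} (hA : Valid (G.fill (.form A)) C)
    (hB : Valid (G.fill (.form B)) C) : Valid (G.fill (.form (.or A B))) C := by
  intro x hx
  obtain ⟨H, y, hy, rfl, hH⟩ := G.exists_of_mem_inst_fill hx
  refine (C.closed_sem.preimage_fill H).clo_subset ?_ hy
  rintro z (hz | hz)
  · exact hA (hH (.form A) z hz)
  · exact hB (hH (.form B) z hz)

theorem mem_clo_of_replaces {S : Set (Str α)} {x y : Str α} (hy : y ∈ S) (h : Replaces x y) :
    x ∈ clo S :=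
  (closed_clo S).mem_of_replaces h (subset_clo S hy)

theorem MCtx.inst_fill_subset (G : MCtx α) {Δ Λ : Str α} (h : Δ.inst ⊆ Λ.inst) :
    (G.fill Δ).inst ⊆ (G.fill Λ).inst := by
  induction G with
  | hole => exact h
  | form A => exact subset_rfl
  | odot Γ Θ h₁ h₂ => exact Set.image2_subset h₁ h₂
  | owedge Γ Θ h₁ h₂ => exact Set.image2_subset h₁ h₂

/-- Structural rules apply to arbitrary structures, so each transfers to instances through the same
Mix-free rule. -/
theorem Deriv.valid {Γ : Str α} {A : Form α} (d : Deriv Γ A) : Valid Γ A := by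
  induction d with
  | id A => exact subset_rfl
  | topAx A => exact fun _ _ => trivial
  | botAx A => exact A.closed_sem.clo_subset (Set.empty_subset _)
  | impL G Δ A B C _ _ h₁ h₂ =>
    refine h₂.fill ?_
    rintro _ ⟨x, hx, y, hy, rfl⟩
    exact subset_clo _ (hy x (h₁ hx))
  | impR Γ A B _ h => exact fun x hx a ha => h (Set.mem_image2_of_mem ha hx)
  | limpL G Δ A B C _ _ h₁ h₂ =>
    refine h₁.fill ?_
    rintro _ ⟨x, hx, y, hy, rfl⟩
    exact subset_clo _ (hx y (h₂ hy))
  | limpR Γ A B _ h => exact fun x hx b hb => h (Set.mem_image2_of_mem hx hb)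
  | prodL G A B C _ h => exact h.fill subset_rfl
  | prodR Γ Δ A B _ _ h₁ h₂ => exact (Set.image2_subset h₁ h₂).trans (subset_clo _)
  | andL G A B C _ h =>
    -- One `x` lies in both interpretations, so `x ⩓ x` is an instance of the premise and
    -- contraction returns to `x`.
    exact h.fill fun x hx => mem_clo_of_replaces (Set.mem_image2_of_mem hx.1 hx.2)
      fun G C h => h.lift (.owedgeC G x C) fun _ => rfl
  | andR Γ A B _ _ h₁ h₂ => exact Set.subset_inter h₁ h₂
  | orL G A B C _ _ h₁ h₂ => exact h₁.fill_or h₂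
  | orR₁ Γ A B _ h => exact fun x hx => subset_clo _ (.inl (h hx))
  | orR₂ Γ A B _ h => exact fun x hx => subset_clo _ (.inr (h hx))
  | owedgeC G Δ A _ h =>
    exact h.fill fun x hx => mem_clo_of_replaces (Set.mem_image2_of_mem hx hx)
      fun G C h => h.lift (.owedgeC G x C) fun _ => rfl
  | odotC G Λ Δ A _ h =>
    refine h.fill ?_
    rintro _ ⟨x, hx, y, hy, rfl⟩
    exact mem_clo_of_replaces (Set.mem_image2_of_mem (Set.mem_image2_of_mem hx hy) hy)
      fun G C h => h.lift (.odotC G x y C) fun _ => rfl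
  | owedgeE G Δ Λ A _ h =>
    refine h.fill ?_
    rintro _ ⟨x, hx, y, hy, rfl⟩
    exact mem_clo_of_replaces (Set.mem_image2_of_mem hy hx)
      fun G C h => h.lift (.owedgeE G y x C) fun _ => rfl
  | owedgeW₁ G Δ Δ' A _ h =>
    refine h.fill ?_
    rintro _ ⟨x, hx, y, hy, rfl⟩
    exact mem_clo_of_replaces hy fun G C h => h.lift (.owedgeW₁ G y x C) fun _ => rfl
  | odotW₁ G Δ Δ' A _ h =>
    refine h.fill ?_
    rintro _ ⟨x, hx, y, hy, rfl⟩
    exact mem_clo_of_replaces hy fun G C h => h.lift (.odotW₁ G y x C) fun _ => rfl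
  | owedgeW₂ G Δ Δ' A _ h =>
    refine h.fill ?_
    rintro _ ⟨x, hx, y, hy, rfl⟩
    exact mem_clo_of_replaces hx fun G C h => h.lift (.owedgeW₂ G x y C) fun _ => rfl
  | odotW₂ G Δ Δ' A _ h =>
    refine h.fill ?_
    rintro _ ⟨x, hx, y, hy, rfl⟩
    exact mem_clo_of_replaces hx fun G C h => h.lift (.odotW₂ G x y C) fun _ => rfl
  | owedgeA₁ G Δ₁ Δ₂ Δ₃ A _ h =>
    refine h.fill ?_
    rintro _ ⟨x, hx, _, ⟨y, hy, z, hz, rfl⟩, rfl⟩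
    exact mem_clo_of_replaces (Set.mem_image2_of_mem (Set.mem_image2_of_mem hx hy) hz)
      fun G C h => h.lift (.owedgeA₁ G x y z C) fun _ => rfl
  | owedgeA₂ G Δ₁ Δ₂ Δ₃ A _ h =>
    refine h.fill ?_
    rintro _ ⟨_, ⟨x, hx, y, hy, rfl⟩, z, hz, rfl⟩
    exact mem_clo_of_replaces (Set.mem_image2_of_mem hx (Set.mem_image2_of_mem hy hz))
      fun G C h => h.lift (.owedgeA₂ G x y z C) fun _ => rfl
  -- Holes may receive different instances, so multiple occurrences need no extra care.
  | mix G Δ A B _ _ _ h₁ h₂ => exact (G.inst_fill_subset (Λ := .form A) h₁).trans h₂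

/-- Mix elimination: every derivable sequent has a derivation without Mix. -/
theorem Derivable.mixFree {Γ : Str α} {A : Form α} (h : Derivable Γ A) : MixFree Γ A := by
  obtain ⟨d⟩ := h
  exact A.mem_sem_and_mixFree.2 Γ (d.valid Γ.mem_inst_self)

end RBL

theorem mainTheorem2 {α : Type*} (Γ : RBL.Str α) (A : RBL.Form α)
    (h : RBL.Derivable Γ A) :
    ∃ d : RBL.Deriv Γ A, ∀ C ∈ d.mixFormulas, C = RBL.Form.bot ∨ C = RBL.Form.top := by
  obtain ⟨d, hd⟩ := h.mixFree
  exact ⟨d, by simp [hd]⟩
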